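/- Notation. Let $a\in\mathbb R$ and $0<\beta\le 2$. For $N\in\mathbb N\cup\{\infty\}$ (with $N\ge 1$) let $f^N:\mathbb R^2\to\mathbb R^2$ be the two-dimensional Coulomb force with cut-off, $f^N(q)=aN^{2\beta}q$ if $|q|\le N^{-\beta}$ and $f^N(q)=a\,q/|q|^2$ if $|q|>N^{-\beta}$; for $N=\infty$, $f^\infty(q)=a\,q/|q|^2$ for $q\ne0$ (and $f^\infty(0)=0$). Points of $\mathbb R^4$ are written $X=({}^1X,{}^2X)$ with position ${}^1X\in\mathbb R^2$ and momentum ${}^2X\in\mathbb R^2$, and $|\cdot|$ is the Euclidean norm. Let $T>0$ and let $k_0$ be a differentiable probability density on $\mathbb R^4$ such that, for some constants $D$ and $\delta>0$, $|\nabla k_0(X)|\le D(1+|X|)^{-(2+\delta)}$ for all $X\in\mathbb R^4$. For each $N\in\mathbb N\cup\{\infty\}$ let $k^N$ be the classical solution on $[0,T]$ of the Vlasov–Poisson equation $$\partial_t k+p\cdot\nabla_q k+(f^N*\tilde k_t)\cdot\nabla_p k=0,\qquad \tilde k_t(q)=\int_{\mathbb R^2}k_t(q,p)\,dp,\qquad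 k|_{t=0}=k_0,$$ that is, $(t,X)\mapsto k^N_t(X)$ is differentiable on $[0,T]\times\mathbb R^4$ and satisfies the equation pointwise, each $k_t^N$ is a probability density, and $\sup_{0\le t\le T}\|\tilde k^N_t\|_\infty<\infty$ for each single $N\in\mathbb N\cup\{\infty\}$. Let $(\varphi^N_{t,s})_{s,t\in[0,T]}$ be the corresponding mean-field flow on $\mathbb R^4$: $t\mapsto\varphi^N_{t,s}(X)$ solves $\dot q=p$, $\dot p=(f^N*\tilde k^N_t)(q)$ on $[0,T]$ with $\varphi^N_{s,s}(X)=X$. Lemma. Suppose that $\sup_{N\in\mathbb N}\sup_{0\le s\le T}\|\tilde k^N_s\|_\infty<\infty$. Then there exists a constant $C>0$ such that for all $X,Y\in\mathbb R^4$, all $N\in\mathbb N\cup\{\infty\}$ and all $t,t_0\in[0,T]$, $$|\varphi^N_{t,t_0}(X)-\varphi^N_{t,t_0}(Y)|\le|X-Y|\,e^{C|t-t_0|}$$ and $$|(f^N*\tilde k^N_t)({}^1X)-(f^N*\tilde k^N_t)({}^1Y)|\le C\,|{}^1X-{}^1Y|.$$ -/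

import Mathlib

open MeasureTheory Set

namespace VlasovPoisson

noncomputable section

/-- Position (or momentum) space `ℝ²` with its Euclidean norm. -/
abbrev Plane : Type := EuclideanSpace ℝ (Fin 2)

/-- One-particle phase space `ℝ⁴ = ℝ² × ℝ²`; `X.1` is the position, `X.2` the momentum.
The measure is Lebesgue measure; Mathlib's norm on a product is the maximum norm, so the
Euclidean norm is introduced separately as `phaseNorm`. -/
abbrev Phase : Type := Plane × Plane

/-- The Euclidean norm of `ℝ⁴`. -/
def phaseNorm (X : Phase) : ℝ := Real.sqrt (‖X.1‖ ^ 2 + ‖X.2‖ ^ 2)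

/-- The two-dimensional Coulomb force of strength `a` with cut-off at distance `N^(-β)`,
for `N ∈ ℕ ∪ {∞}`; for `N = ∞` there is no cut-off (and the value at the origin is `0`). -/
def force (a β : ℝ) : ℕ∞ → Plane → Plane
  | none => fun q => (a / ‖q‖ ^ 2) • q
  | some n => fun q =>
      if ‖q‖ ≤ (n : ℝ) ^ (-β) then (a * (n : ℝ) ^ (2 * β)) • q else (a / ‖q‖ ^ 2) • q

/-- A probability density on phase space. -/
structure IsProbDensity (u : Phase → ℝ) : Prop where
  nonneg : ∀ X, 0 ≤ u X
  integrable : Integrable u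
  integral_eq_one : ∫ X, u X = 1

/-- The spatial density `q ↦ ∫ u(q,p) dp` of a phase space density. -/
def spatialDensity (u : Phase → ℝ) (q : Plane) : ℝ := ∫ p : Plane, u (q, p)

/-- The mean-field force `f^N * ũ` at `q`, where `ũ` is the spatial density of `u`. -/
def meanFieldForce (a β : ℝ) (N : ℕ∞) (u : Phase → ℝ) (q : Plane) : Plane :=
  ∫ y : Plane, spatialDensity u y • force a β N (q - y)

/-- `k` is a solution on `[0,T]` of the Vlasov-Poisson equation
`∂ₜ k + p · ∇_q k + (f^N * k̃ₜ) · ∇_p k = 0` with initial datum `k₀`: a differentiable curve of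
probability densities whose spatial densities are essentially bounded on `[0,T]` (with a bound
that may depend on the solution, hence on `N`), so that `f^N * k̃ₜ` is given by absolutely
convergent integrals at every point, also for `N = ∞`. -/
structure IsVlasovSolution (a β T : ℝ) (N : ℕ∞) (k₀ : Phase → ℝ) (k : ℝ → Phase → ℝ) :
    Prop where
  initial : k 0 = k₀
  density : ∀ t ∈ Icc 0 T, IsProbDensity (k t)
  bounded : (⨆ t ∈ Icc 0 T, eLpNorm (spatialDensity (k t)) ⊤ volume) < ⊤
  differentiable :
    DifferentiableOn ℝ (fun z : ℝ × Phase => k z.1 z.2) (Icc 0 T ×ˢ (univ : Set Phase))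
  equation : ∀ t ∈ Icc 0 T, ∀ X : Phase,
    derivWithin (fun s => k s X) (Icc 0 T) t
      + fderiv ℝ (k t) X (X.2, 0)
      + fderiv ℝ (k t) X (0, meanFieldForce a β N (k t) X.1) = 0

/-- `φ` is the effective flow on `[0,T]` belonging to `k`: `t ↦ φ t s X` solves
`q' = p`, `p' = (f^N * k̃ₜ)(q)` on `[0,T]` with value `X` at time `s`. -/
structure IsMeanFieldFlow (a β T : ℝ) (N : ℕ∞) (k : ℝ → Phase → ℝ)
    (φ : ℝ → ℝ → Phase → Phase) : Prop where
  initial : ∀ s ∈ Icc 0 T, ∀ X, φ s s X = X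
  equation : ∀ s ∈ Icc 0 T, ∀ X, ∀ t ∈ Icc 0 T,
    HasDerivWithinAt (fun r => φ r s X)
      ((φ t s X).2, meanFieldForce a β N (k t) (φ t s X).1) (Icc 0 T) t

end

end VlasovPoisson

open VlasovPoisson

/-! The flow estimate follows from the second estimate by Gronwall's inequality
(`phaseNorm_sub_le_mul_exp`), so the point is that the mean-field force is Lipschitz in the position,
uniformly in the cut-off.

A density that is merely bounded produces a log-Lipschitz force. This is expressed by Hölder bounds
of all exponents `1 - θ < 1` with constants of order `1 / θ` (`norm_coulombField_sub_le_rpow`), which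
come from interpolating the inversion estimate `|K x - K y| ≤ |x - y| / (|x| |y|)` of the kernel.
By Osgood's argument the characteristics depend Hölder continuously on their end points, with the
exponent `exp (-K T)` (`norm_sub_le_rpow_of_logLipschitz`). A solution is constant along the
characteristics (`IsVlasovSolution.eq_initial_comp_flow`), these change momenta by a bounded amount
only, and the gradient of the initial datum is integrable in the momentum; hence the spatial density
is Hölder continuous on small scales (`abs_spatialDensity_sub_le`).

Finally, a bounded density that is Hölder continuous produces a Lipschitz force
(`norm_coulombField_sub_le_of_holder`): near a point `x`, the density is split into its increment
from its value at `x`, which weakens the singularity `|x - z|⁻²` of the increments of the kernel to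
an integrable one, and a constant times a radial profile around `x`, whose field is Lipschitz at `x`
because the kernel is odd.

Since all kernels satisfy the same inversion estimate, whatever their cut-off, all the constants are
uniform in it. -/

namespace VlasovPoisson

/-! ### The kernel -/

/-- The two-dimensional Coulomb kernel `q / |q|²`, regularised below the length `ρ`: on
`|q| ≤ ρ` it is linear. The value `ρ = 0` is the kernel without cut-off, which vanishes at the
origin because of the convention `0⁻¹ = 0`. -/
noncomputable def coulombKernel (ρ : ℝ) (q : Plane) : Plane := ((max ‖q‖ ρ) ^ 2)⁻¹ • q

/-- The cut-off length is `n ^ (-β)` for finite `n` and `0` for `∞`; its value plays no role, as all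
the estimates are uniform in it. -/
lemma exists_force_eq_smul_coulombKernel (a β : ℝ) {N : ℕ∞} (hN : 1 ≤ N) :
    ∃ ρ : ℝ, ∀ q, force a β N q = a • coulombKernel ρ q := by
  induction N using ENat.recTopCoe with
  | top =>
    refine ⟨0, fun q => ?_⟩
    change (a / ‖q‖ ^ 2) • q = _
    rw [coulombKernel, max_eq_left (norm_nonneg q), smul_smul, div_eq_mul_inv]
  | coe n =>
    have hn : 0 < n := by exact_mod_cast hN
    have hn' : (0 : ℝ) < n := by exact_mod_cast hn
    refine ⟨(n : ℝ) ^ (-β), fun q => ?_⟩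
    change (if ‖q‖ ≤ (n : ℝ) ^ (-β) then (a * (n : ℝ) ^ (2 * β)) • q else (a / ‖q‖ ^ 2) • q) = _
    split_ifs with h
    · rw [coulombKernel, max_eq_right h, smul_smul, ← Real.rpow_natCast, ← Real.rpow_mul hn'.le,
        ← Real.rpow_neg hn'.le]
      congr 3
      push_cast
      ring
    · rw [coulombKernel, max_eq_left (not_le.1 h).le, smul_smul, div_eq_mul_inv]

lemma coulombKernel_neg (ρ : ℝ) (q : Plane) : coulombKernel ρ (-q) = -coulombKernel ρ q := by
  simp [coulombKernel]

lemma measurable_coulombKernel (ρ : ℝ) : Measurable (coulombKernel ρ) := by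
  unfold coulombKernel
  fun_prop

lemma norm_coulombKernel_le (ρ : ℝ) (q : Plane) :
    ‖coulombKernel ρ q‖ ≤ ‖q‖⁻¹ := by
  rcases eq_or_ne q 0 with rfl | hq
  · simp [coulombKernel]
  have hq' : 0 < ‖q‖ := norm_pos_iff.2 hq
  rw [coulombKernel, norm_smul, norm_inv, norm_pow,
    Real.norm_of_nonneg (le_max_of_le_left (norm_nonneg q))]
  calc ((max ‖q‖ ρ) ^ 2)⁻¹ * ‖q‖ ≤ (‖q‖ ^ 2)⁻¹ * ‖q‖ := by gcongr; exact le_max_left _ _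
    _ = ‖q‖⁻¹ := by field_simp

/-- The inversion estimate. Without cut-off it is the identity
`|x / |x|² - y / |y|²| = |x - y| / (|x| |y|)`; the cut-off only decreases the left-hand side. -/
lemma norm_coulombKernel_sub_le (ρ : ℝ) {x y : Plane} (hx : x ≠ 0) (hy : y ≠ 0) :
    ‖coulombKernel ρ x - coulombKernel ρ y‖ ≤ ‖x - y‖ / (‖x‖ * ‖y‖) := by
  have hx' : 0 < ‖x‖ := norm_pos_iff.2 hx
  have hy' : 0 < ‖y‖ := norm_pos_iff.2 hy
  set s := max ‖x‖ ρ with hs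
  set t := max ‖y‖ ρ with ht
  have hxs : ‖x‖ ≤ s := le_max_left _ _
  have hyt : ‖y‖ ≤ t := le_max_left _ _
  have hs0 : 0 < s := hx'.trans_le hxs
  have ht0 : 0 < t := hy'.trans_le hyt
  have hxa : ‖x‖ ^ 2 * (s ^ 2)⁻¹ ≤ 1 := by
    rw [← div_eq_mul_inv, div_le_one (by positivity)]; gcongr
  have hyb : ‖y‖ ^ 2 * (t ^ 2)⁻¹ ≤ 1 := by
    rw [← div_eq_mul_inv, div_le_one (by positivity)]; gcongr
  have key : 0 ≤ ((s ^ 2)⁻¹ - (t ^ 2)⁻¹) * (‖y‖ ^ 2 * (t ^ 2)⁻¹ - ‖x‖ ^ 2 * (s ^ 2)⁻¹) := by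
    rcases lt_trichotomy s t with h | h | h
    · have : ‖y‖ = t := by
        rcases max_choice ‖y‖ ρ with h' | h'
        · exact (ht.trans h').symm
        · exact absurd (h.trans_eq (ht.trans h')) (not_lt.2 (le_max_right _ _))
      have h1 : ‖y‖ ^ 2 * (t ^ 2)⁻¹ = 1 := by rw [this]; field_simp
      rw [h1]
      refine mul_nonneg (sub_nonneg.2 ?_) (sub_nonneg.2 hxa)
      gcongr
    · simp [h]
    · have : ‖x‖ = s := by
        rcases max_choice ‖x‖ ρ with h' | h'
        · exact (hs.trans h').symm
        · exact absurd (h.trans_eq (hs.trans h')) (not_lt.2 (le_max_right _ _))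
      have h1 : ‖x‖ ^ 2 * (s ^ 2)⁻¹ = 1 := by rw [this]; field_simp
      rw [h1]
      refine mul_nonneg_of_nonpos_of_nonpos (sub_nonpos.2 ?_) (sub_nonpos.2 hyb)
      gcongr
  have hle : ‖coulombKernel ρ x - coulombKernel ρ y‖ ≤ ‖x - y‖ / (s * t) := by
    refine le_of_sq_le_sq ?_ (by positivity)
    rw [coulombKernel, coulombKernel, div_pow, norm_sub_sq_real, norm_sub_sq_real, norm_smul,
      norm_smul, real_inner_smul_left, real_inner_smul_right, Real.norm_of_nonneg (by positivity),
      Real.norm_of_nonneg (by positivity), ← hs, ← ht, div_eq_mul_inv, mul_pow s t, mul_inv]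
    nlinarith [key]
  refine hle.trans ?_
  gcongr

/-! ### Integrals against powers of the distance -/

/-- Separates the two singularities `s = 0` and `t = 0` of a product: the smaller of the two lengths
dominates. -/
lemma rpow_mul_inv_le {s t θ : ℝ} (hs : 0 < s) (ht : 0 < t) (hθ : θ ≤ 1) :
    s ^ (θ - 1) * t⁻¹ ≤ s ^ (θ - 2) + t ^ (θ - 2) := by
  have e : ∀ r : ℝ, 0 < r → r ^ (θ - 2) = r ^ (θ - 1) * r⁻¹ := fun r hr => by
    rw [← Real.rpow_neg_one r, ← Real.rpow_add hr]; congr 1; ring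
  rcases le_total s t with h | h
  · calc s ^ (θ - 1) * t⁻¹ ≤ s ^ (θ - 1) * s⁻¹ := by gcongr
      _ = s ^ (θ - 2) := (e s hs).symm
      _ ≤ _ := le_add_of_nonneg_right (by positivity)
  · calc s ^ (θ - 1) * t⁻¹ ≤ t ^ (θ - 1) * t⁻¹ := by
          gcongr ?_ * _
          exact Real.rpow_le_rpow_of_nonpos ht h (by linarith)
      _ = t ^ (θ - 2) := (e t ht).symm
      _ ≤ _ := le_add_of_nonneg_left (by positivity)

/-- Interpolation between the two bounds `|x - y| / (|x| |y|)` and `1 / |x| + 1 / |y|` for the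
increments of the kernel: the increments are Hölder continuous of exponent `1 - θ`, at the price of
a singularity of order `2 - θ`, which is integrable in the plane. -/
lemma norm_coulombKernel_sub_le_rpow (ρ : ℝ) {θ : ℝ} (hθ : 0 ≤ θ) (hθ1 : θ ≤ 1)
    {x y : Plane} (hx : x ≠ 0) (hy : y ≠ 0) :
    ‖coulombKernel ρ x - coulombKernel ρ y‖
      ≤ 2 * ‖x - y‖ ^ (1 - θ) * (‖x‖ ^ (θ - 2) + ‖y‖ ^ (θ - 2)) := by
  have hx' : 0 < ‖x‖ := norm_pos_iff.2 hx
  have hy' : 0 < ‖y‖ := norm_pos_iff.2 hy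
  refine (norm_coulombKernel_sub_le ρ hx hy).trans ?_
  rcases eq_or_ne x y with rfl | hxy
  · simp only [sub_self, norm_zero, zero_div]; positivity
  have hd : 0 < ‖x - y‖ := norm_pos_iff.2 (sub_ne_zero.2 hxy)
  have h1 : ‖x - y‖ = ‖x - y‖ ^ (1 - θ) * ‖x - y‖ ^ θ := by
    rw [← Real.rpow_add hd]; simp
  have h2 : ‖x - y‖ ^ θ ≤ ‖x‖ ^ θ + ‖y‖ ^ θ :=
    (Real.rpow_le_rpow hd.le (norm_sub_le x y) hθ).trans
      (Real.rpow_add_le_add_rpow hx'.le hy'.le hθ hθ1)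
  have e : ∀ r : ℝ, 0 < r → r ^ (θ - 1) = r ^ θ * r⁻¹ := fun r hr => by
    rw [Real.rpow_sub_one hr.ne', div_eq_mul_inv]
  have h3 := rpow_mul_inv_le hx' hy' hθ1
  have h4 := rpow_mul_inv_le hy' hx' hθ1
  rw [e _ hx'] at h3
  rw [e _ hy'] at h4
  calc ‖x - y‖ / (‖x‖ * ‖y‖)
      = ‖x - y‖ ^ (1 - θ) * (‖x - y‖ ^ θ * (‖x‖⁻¹ * ‖y‖⁻¹)) := by
        conv_lhs => rw [h1]
        rw [div_eq_mul_inv, mul_inv]; ring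
    _ ≤ ‖x - y‖ ^ (1 - θ) * ((‖x‖ ^ θ + ‖y‖ ^ θ) * (‖x‖⁻¹ * ‖y‖⁻¹)) := by gcongr
    _ ≤ ‖x - y‖ ^ (1 - θ) * (2 * (‖x‖ ^ (θ - 2) + ‖y‖ ^ (θ - 2))) := by
        refine mul_le_mul_of_nonneg_left ?_ (by positivity)
        linarith
    _ = _ := by ring

lemma ae_ne_plane (x : Plane) : ∀ᵐ z : Plane, z ≠ x := by
  simp [ae_iff]

/-- Polar coordinates in the plane: `|z|^(s - 2)` is integrable over the unit disc for `s > 0`. -/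
lemma integrable_unit_indicator_rpow {s : ℝ} (hs : 0 < s) :
    Integrable (fun z : Plane => (Iic (1 : ℝ)).indicator (fun r => r ^ (s - 2)) ‖z‖) ∧
    ∫ z : Plane, (Iic (1 : ℝ)).indicator (fun r => r ^ (s - 2)) ‖z‖ = 2 * Real.pi / s := by
  have hdim : Module.finrank ℝ Plane = 2 := by simp
  have heq : EqOn (fun r : ℝ => r ^ (Module.finrank ℝ Plane - 1) •
      (Iic (1 : ℝ)).indicator (fun r => r ^ (s - 2)) r)
      ((Iic (1 : ℝ)).indicator (fun r => r ^ (s - 1))) (Ioi 0) := by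
    intro r hr
    have hr : 0 < r := hr
    simp only [hdim, smul_eq_mul, indicator]
    split_ifs
    · rw [← Real.rpow_natCast, ← Real.rpow_add hr]; congr 1; push_cast; ring
    · simp
  have hset : Iic (1 : ℝ) ∩ Ioi 0 = Ioc 0 1 := by ext; simp [and_comm]
  constructor
  · rw [integrable_fun_norm_addHaar volume (f := (Iic (1 : ℝ)).indicator (fun r => r ^ (s - 2))),
      integrableOn_congr_fun heq measurableSet_Ioi, IntegrableOn,
      integrable_indicator_iff measurableSet_Iic, IntegrableOn,
      Measure.restrict_restrict measurableSet_Iic, hset]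
    exact (intervalIntegrable_iff_integrableOn_Ioc_of_le zero_le_one).1
      (intervalIntegral.intervalIntegrable_rpow' (by linarith))
  · rw [integral_fun_norm_addHaar volume ((Iic (1 : ℝ)).indicator (fun r => r ^ (s - 2))),
      setIntegral_congr_fun measurableSet_Ioi heq, integral_indicator measurableSet_Iic,
      Measure.restrict_restrict measurableSet_Iic, hset,
      ← intervalIntegral.integral_of_le zero_le_one, integral_rpow (Or.inl (by linarith)), hdim,
      Measure.real, EuclideanSpace.volume_ball_fin_two]
    simp [Real.zero_rpow hs.ne', Real.pi_pos.le]
    ring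

/-- A bounded integrable function can be integrated against `|y - z|^(s - 2)`, with a bound that
does not depend on `y`: within distance `1` the bound of `v` and polar coordinates are used,
farther away the weight is at most `1`. -/
lemma integrable_mul_rpow_norm_sub {v : Plane → ℝ} {M s : ℝ} (hs : 0 < s) (hs2 : s ≤ 2)
    (hv : Integrable v) (hv0 : ∀ᵐ z, 0 ≤ v z) (hvM : ∀ᵐ z, v z ≤ M) (y : Plane) :
    Integrable (fun z => v z * ‖y - z‖ ^ (s - 2)) ∧
    ∫ z, v z * ‖y - z‖ ^ (s - 2) ≤ M * (2 * Real.pi / s) + ∫ z, v z := by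
  obtain ⟨hi, he⟩ := integrable_unit_indicator_rpow hs
  set h : Plane → ℝ := fun z => (Iic (1 : ℝ)).indicator (fun r => r ^ (s - 2)) ‖z‖ with hh
  have hi' : Integrable (fun z => M * h (y - z) + v z) :=
    ((hi.comp_sub_left y).const_mul M).add hv
  have hb : ∀ᵐ z, v z * ‖y - z‖ ^ (s - 2) ≤ M * h (y - z) + v z := by
    filter_upwards [hv0, hvM] with z h0 h1
    simp only [hh, indicator, mem_Iic]
    split_ifs with hz
    · have : v z * ‖y - z‖ ^ (s - 2) ≤ M * ‖y - z‖ ^ (s - 2) := by gcongr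
      linarith
    · have : ‖y - z‖ ^ (s - 2) ≤ 1 :=
        Real.rpow_le_one_of_one_le_of_nonpos (not_le.1 hz).le (by linarith)
      nlinarith
  have hint : Integrable (fun z => v z * ‖y - z‖ ^ (s - 2)) := by
    refine hi'.mono' (hv.aestronglyMeasurable.mul
      (Measurable.aestronglyMeasurable (by fun_prop))) ?_
    filter_upwards [hb, hv0] with z h1 h0
    rwa [Real.norm_of_nonneg (by positivity)]
  refine ⟨hint, (integral_mono_ae hint hi' hb).trans_eq ?_⟩
  rw [integral_add ((hi.comp_sub_left y).const_mul M) hv, integral_const_mul,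
    integral_sub_left_eq_self h volume y, he]

/-! ### The field of a bounded density -/

/-- The field generated by the spatial density `u` through the kernel with cut-off length `ρ`. -/
noncomputable def coulombField (ρ : ℝ) (u : Plane → ℝ) (x : Plane) : Plane :=
  ∫ z, u z • coulombKernel ρ (x - z)

/-- A probability density on the plane that is essentially bounded by `M`. -/
structure IsBoundedDensity (M : ℝ) (u : Plane → ℝ) : Prop where
  integrable : Integrable u
  nonneg : ∀ z, 0 ≤ u z
  integral_eq_one : ∫ z, u z = 1
  ae_le : ∀ᵐ z, u z ≤ M

lemma IsBoundedDensity.bound_nonneg {M : ℝ} {u : Plane → ℝ} (hu : IsBoundedDensity M u) :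
    0 ≤ M := by
  obtain ⟨z, hz⟩ := hu.ae_le.exists
  exact (hu.nonneg z).trans hz

lemma IsBoundedDensity.ae_abs_le {M : ℝ} {u : Plane → ℝ} (hu : IsBoundedDensity M u) :
    ∀ᵐ z, |u z| ≤ M := by
  filter_upwards [hu.ae_le] with z hz
  rwa [abs_of_nonneg (hu.nonneg z)]

lemma integrable_smul_coulombKernel (ρ : ℝ) {w : Plane → ℝ} {M : ℝ} (hw : Integrable w)
    (hM : ∀ᵐ z, |w z| ≤ M) (x : Plane) :
    Integrable (fun z => w z • coulombKernel ρ (x - z)) ∧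
    ‖∫ z, w z • coulombKernel ρ (x - z)‖ ≤ 2 * Real.pi * M + ∫ z, |w z| := by
  obtain ⟨hi, he⟩ := integrable_mul_rpow_norm_sub (s := 1) one_pos one_le_two hw.abs
    (.of_forall fun z => abs_nonneg _) hM x
  have hb : ∀ z, ‖w z • coulombKernel ρ (x - z)‖ ≤ |w z| * ‖x - z‖ ^ ((1 : ℝ) - 2) := fun z => by
    rw [norm_smul, Real.norm_eq_abs, show (1 : ℝ) - 2 = -1 by norm_num, Real.rpow_neg_one]
    gcongr
    exact norm_coulombKernel_le ρ _
  refine ⟨hi.mono' (hw.aestronglyMeasurable.smul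
    ((measurable_coulombKernel ρ).comp (by fun_prop)).aestronglyMeasurable) (.of_forall hb), ?_⟩
  refine (norm_integral_le_of_norm_le hi (.of_forall hb)).trans (he.trans_eq ?_)
  ring

lemma norm_coulombField_le (ρ : ℝ) {u : Plane → ℝ} {M : ℝ} (hu : IsBoundedDensity M u)
    (x : Plane) : ‖coulombField ρ u x‖ ≤ 2 * Real.pi * M + 1 := by
  have h := (integrable_smul_coulombKernel ρ hu.integrable hu.ae_abs_le x).2
  simp only [abs_of_nonneg (hu.nonneg _), hu.integral_eq_one] at h
  exact h

/-- The field of a bounded density is Hölder continuous of every exponent `1 - θ < 1`, with a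
constant of order `1 / θ`; optimised over `θ`, this is log-Lipschitz continuity. -/
lemma norm_coulombField_sub_le_rpow (ρ : ℝ) {u : Plane → ℝ} {M θ : ℝ} (hu : IsBoundedDensity M u)
    (hθ : 0 < θ) (hθ1 : θ ≤ 1) (x y : Plane) :
    ‖coulombField ρ u x - coulombField ρ u y‖
      ≤ 4 * (2 * Real.pi * M / θ + 1) * ‖x - y‖ ^ (1 - θ) := by
  obtain ⟨hx, -⟩ := integrable_smul_coulombKernel ρ hu.integrable hu.ae_abs_le x
  obtain ⟨hy, -⟩ := integrable_smul_coulombKernel ρ hu.integrable hu.ae_abs_le y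
  have h := fun y => integrable_mul_rpow_norm_sub (s := θ) hθ (by linarith) hu.integrable
    (.of_forall hu.nonneg) hu.ae_le y
  rw [coulombField, coulombField, ← integral_sub hx hy]
  have hb : ∀ᵐ z, ‖u z • coulombKernel ρ (x - z) - u z • coulombKernel ρ (y - z)‖
      ≤ 2 * ‖x - y‖ ^ (1 - θ) * (u z * ‖x - z‖ ^ (θ - 2) + u z * ‖y - z‖ ^ (θ - 2)) := by
    filter_upwards [ae_ne_plane x, ae_ne_plane y] with z hzx hzy
    have h1 := norm_coulombKernel_sub_le_rpow ρ hθ.le hθ1 (sub_ne_zero.2 hzx.symm)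
      (sub_ne_zero.2 hzy.symm)
    rw [sub_sub_sub_cancel_right] at h1
    rw [← smul_sub, norm_smul, Real.norm_of_nonneg (hu.nonneg z)]
    calc _ ≤ u z * _ := mul_le_mul_of_nonneg_left h1 (hu.nonneg z)
      _ = _ := by ring
  refine (norm_integral_le_of_norm_le (((h x).1.add (h y).1).const_mul _) hb).trans ?_
  rw [integral_const_mul, integral_add' (h x).1 (h y).1]
  have hx2 := (h x).2
  have hy2 := (h y).2
  rw [hu.integral_eq_one] at hx2 hy2
  calc _ ≤ 2 * ‖x - y‖ ^ (1 - θ) * ((M * (2 * Real.pi / θ) + 1) + (M * (2 * Real.pi / θ) + 1)) := by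
        gcongr
    _ = _ := by ring

/-- The radial tent function of height `1` supported in the ball of radius `r`. -/
noncomputable def tent (r : ℝ) (z : Plane) : ℝ := max 0 (1 - ‖z‖ / r)

lemma tent_nonneg (r : ℝ) (z : Plane) : 0 ≤ tent r z := le_max_left _ _

lemma tent_neg (r : ℝ) (z : Plane) : tent r (-z) = tent r z := by simp [tent]

lemma one_sub_tent_le (r : ℝ) (z : Plane) : 1 - tent r z ≤ ‖z‖ / r := by
  have : 1 - ‖z‖ / r ≤ tent r z := le_max_right _ _
  linarith

lemma continuous_tent (r : ℝ) : Continuous (tent r) := by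
  unfold tent
  fun_prop

lemma abs_tent_sub_le {r : ℝ} (hr : 0 < r) (z w : Plane) :
    |tent r z - tent r w| ≤ ‖z - w‖ / r := by
  unfold tent
  refine (abs_max_sub_max_le_max _ _ _ _).trans ?_
  rw [sub_self, abs_zero, max_eq_right (abs_nonneg _), sub_sub_sub_cancel_left, ← sub_div, abs_div,
    abs_of_pos hr, abs_sub_comm]
  gcongr
  exact abs_norm_sub_norm_le z w

lemma tent_le_indicator {r : ℝ} (hr : 0 < r) (z : Plane) :
    tent r z ≤ (Metric.closedBall (0 : Plane) r).indicator 1 z := by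
  by_cases hz : ‖z‖ ≤ r
  · rw [indicator_of_mem (by simpa using hz)]
    have : 0 ≤ ‖z‖ / r := by positivity
    exact max_le zero_le_one (by simpa using this)
  · rw [indicator_of_notMem (by simpa using hz)]
    have : 1 ≤ ‖z‖ / r := (one_le_div hr).2 (not_le.1 hz).le
    exact max_le le_rfl (by linarith)

lemma tent_le_one {r : ℝ} (hr : 0 < r) (z : Plane) : tent r z ≤ 1 :=
  max_le zero_le_one (sub_le_self _ (by positivity))

lemma integrable_indicator_closedBall (r : ℝ) :
    Integrable ((Metric.closedBall (0 : Plane) r).indicator (1 : Plane → ℝ)) :=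
  (integrable_indicator_iff Metric.isClosed_closedBall.measurableSet).2
    (integrableOn_const (isCompact_closedBall _ _).measure_ne_top)

lemma integral_indicator_closedBall (r : ℝ) :
    ∫ z, (Metric.closedBall (0 : Plane) r).indicator (1 : Plane → ℝ) z
      = volume.real (Metric.closedBall (0 : Plane) r) :=
  integral_indicator_one Metric.isClosed_closedBall.measurableSet

lemma integrable_tent {r : ℝ} (hr : 0 < r) : Integrable (tent r) :=
  (integrable_indicator_closedBall r).mono' (continuous_tent r).aestronglyMeasurable
    (.of_forall fun z => by
      rw [Real.norm_of_nonneg (tent_nonneg r z)]; exact tent_le_indicator hr z)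

lemma integral_tent_le {r : ℝ} (hr : 0 < r) :
    ∫ z, tent r z ≤ volume.real (Metric.closedBall (0 : Plane) r) :=
  (integral_mono (integrable_tent hr) (integrable_indicator_closedBall r)
    (tent_le_indicator hr)).trans_eq (integral_indicator_closedBall r)

lemma integral_tent_smul_coulombKernel (ρ r : ℝ) : ∫ z, tent r z • coulombKernel ρ z = 0 := by
  have h := integral_neg_eq_self (fun z => tent r z • coulombKernel ρ z) volume
  simp only [tent_neg, coulombKernel_neg, smul_neg, integral_neg] at h
  have h2 : (2 : ℝ) • ∫ z, tent r z • coulombKernel ρ z = 0 := by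
    rw [two_smul]; nth_rewrite 1 [← h]; exact neg_add_cancel _
  exact (smul_eq_zero.1 h2).resolve_left two_ne_zero

/-- The field of a charge distributed radially around `x` is Lipschitz at `x`: by symmetry it
vanishes at `x`, and at `y` it is the field of the difference of the charge and its translate by
`x - y`, which is of order `‖x - y‖`. -/
lemma norm_integral_tent_smul_sub_le (ρ : ℝ) {r : ℝ} (hr : 0 < r) (x y : Plane) :
    ‖∫ z, tent r (x - z) • (coulombKernel ρ (x - z) - coulombKernel ρ (y - z))‖
      ≤ (2 * Real.pi + 2 * volume.real (Metric.closedBall (0 : Plane) r)) / r * ‖x - y‖ := by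
  have htx : Integrable (fun z => tent r (x - z)) := (integrable_tent hr).comp_sub_left x
  have hb : ∀ᵐ z, |tent r (x - z)| ≤ 1 := .of_forall fun z => by
    rw [abs_of_nonneg (tent_nonneg _ _)]; exact tent_le_one hr _
  obtain ⟨hx, -⟩ := integrable_smul_coulombKernel ρ htx hb x
  obtain ⟨hy, -⟩ := integrable_smul_coulombKernel ρ htx hb y
  simp only [smul_sub]
  rw [integral_sub hx hy,
    integral_sub_left_eq_self (fun z => tent r z • coulombKernel ρ z) volume x,
    integral_tent_smul_coulombKernel, zero_sub, norm_neg]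
  set χ : Plane → ℝ := fun z => tent r (x - z) with hχ
  set ψ : Plane → ℝ := fun z => tent r (y - z) with hψ
  have hty : Integrable ψ := (integrable_tent hr).comp_sub_left y
  have hby : ∀ᵐ z, |ψ z| ≤ 1 := .of_forall fun z => by
    rw [abs_of_nonneg (tent_nonneg _ _)]; exact tent_le_one hr _
  obtain ⟨hy', -⟩ := integrable_smul_coulombKernel ρ hty hby y
  have h0 : ∫ z, ψ z • coulombKernel ρ (y - z) = 0 := by
    rw [integral_sub_left_eq_self (fun z => tent r z • coulombKernel ρ z) volume y,
      integral_tent_smul_coulombKernel]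
  have hd : ∀ z, |χ z - ψ z| ≤ ‖x - y‖ / r := fun z => by
    simpa only [hχ, hψ, sub_sub_sub_cancel_right] using abs_tent_sub_le hr (x - z) (y - z)
  have hbound : ∫ z, |χ z - ψ z|
      ≤ ‖x - y‖ / r * (2 * volume.real (Metric.closedBall (0 : Plane) r)) := by
    have hI := integrable_indicator_closedBall r
    have hIx := hI.comp_sub_left x
    have hIy := hI.comp_sub_left y
    have hle : ∀ z, |χ z - ψ z| ≤ ‖x - y‖ / r *
        ((Metric.closedBall (0 : Plane) r).indicator (1 : Plane → ℝ) (x - z)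
          + (Metric.closedBall (0 : Plane) r).indicator (1 : Plane → ℝ) (y - z)) := fun z => by
      have h0x : 0 ≤ (Metric.closedBall (0 : Plane) r).indicator (1 : Plane → ℝ) (x - z) :=
        indicator_nonneg (fun _ _ => zero_le_one) _
      have h0y : 0 ≤ (Metric.closedBall (0 : Plane) r).indicator (1 : Plane → ℝ) (y - z) :=
        indicator_nonneg (fun _ _ => zero_le_one) _
      by_cases h : x - z ∈ Metric.closedBall (0 : Plane) r ∨ y - z ∈ Metric.closedBall (0 : Plane) r
      · refine (hd z).trans (le_mul_of_one_le_right (by positivity) ?_)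
        rcases h with h | h
        · rw [indicator_of_mem h, Pi.one_apply]; linarith
        · rw [indicator_of_mem h (1 : Plane → ℝ), Pi.one_apply]; linarith
      · rw [not_or] at h
        have hx0 := tent_le_indicator hr (x - z)
        have hy0 := tent_le_indicator hr (y - z)
        rw [indicator_of_notMem h.1] at hx0
        rw [indicator_of_notMem h.2] at hy0
        have e1 : χ z = 0 := le_antisymm hx0 (tent_nonneg _ _)
        have e2 : ψ z = 0 := le_antisymm hy0 (tent_nonneg _ _)
        rw [e1, e2, sub_self, abs_zero]
        positivity
    refine (integral_mono (htx.sub hty).abs ((hIx.add hIy).const_mul _) hle).trans_eq ?_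
    rw [integral_const_mul, integral_add' hIx hIy, integral_sub_left_eq_self _ volume x,
      integral_sub_left_eq_self _ volume y, integral_indicator_closedBall]
    ring
  obtain ⟨-, hfin⟩ := integrable_smul_coulombKernel ρ (htx.sub hty) (.of_forall hd) y
  have heq : ∫ z, χ z • coulombKernel ρ (y - z)
      = ∫ z, ((fun z => χ z) - ψ) z • coulombKernel ρ (y - z) := by
    simp only [Pi.sub_apply, sub_smul]
    rw [integral_sub hy hy', h0, sub_zero]
  rw [heq]
  refine hfin.trans ?_
  calc _ ≤ 2 * Real.pi * (‖x - y‖ / r)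
        + ‖x - y‖ / r * (2 * volume.real (Metric.closedBall (0 : Plane) r)) := by
        gcongr; exact hbound
    _ = _ := by ring

/-- The field of a bounded density that is Hölder continuous on small scales is Lipschitz, with a
constant that does not depend on the cut-off. -/
lemma norm_coulombField_sub_le_of_holder (ρ : ℝ) {u : Plane → ℝ} {M H γ r : ℝ}
    (hu : IsBoundedDensity M u) (huM : ∀ z, u z ≤ M) (hr : 0 < r) (hγ : 0 < γ) (hγ1 : γ ≤ 1)
    (hH : 0 ≤ H) (hol : ∀ x z, ‖x - z‖ ≤ r → |u z - u x| ≤ H * ‖x - z‖ ^ γ) (x y : Plane) :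
    ‖coulombField ρ u x - coulombField ρ u y‖
      ≤ ((2 * Real.pi * M + 1) / r
          + 2 * H * (2 * Real.pi / γ + volume.real (Metric.closedBall (0 : Plane) r))
          + M * ((2 * Real.pi + 2 * volume.real (Metric.closedBall (0 : Plane) r)) / r))
        * ‖x - y‖ := by
  set V := volume.real (Metric.closedBall (0 : Plane) r) with hV
  have hM := hu.bound_nonneg
  set χ : Plane → ℝ := fun z => tent r (x - z) with hχ
  have hχc : Continuous χ := (continuous_tent r).comp (by fun_prop)
  have hχi : Integrable χ := (integrable_tent hr).comp_sub_left x
  have hχ0 : ∀ z, 0 ≤ χ z := fun z => tent_nonneg _ _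
  have hχ1 : ∀ z, χ z ≤ 1 := fun z => tent_le_one hr _
  set Δ : Plane → Plane := fun z => coulombKernel ρ (x - z) - coulombKernel ρ (y - z) with hΔ
  have hΔint : ∀ {w : Plane → ℝ} {B : ℝ}, Integrable w → (∀ᵐ z, |w z| ≤ B) →
      Integrable (fun z => w z • Δ z) := fun hw hB => by
    simp only [hΔ, smul_sub]
    exact (integrable_smul_coulombKernel ρ hw hB x).1.sub
      (integrable_smul_coulombKernel ρ hw hB y).1
  -- `1 - χ` vanishes linearly at `x`, which removes the singularity of the increment there
  have hA : Integrable (fun z => (1 - χ z) * u z) := by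
    refine hu.integrable.mono' ((hχc.measurable.const_sub 1).aestronglyMeasurable.mul
      hu.integrable.aestronglyMeasurable) (.of_forall fun z => ?_)
    rw [Real.norm_of_nonneg (mul_nonneg (by linarith [hχ1 z]) (hu.nonneg z))]
    exact mul_le_of_le_one_left (hu.nonneg z) (by linarith [hχ0 z])
  have hAM : ∀ᵐ z, |(1 - χ z) * u z| ≤ M := .of_forall fun z => by
    rw [abs_of_nonneg (mul_nonneg (by linarith [hχ1 z]) (hu.nonneg z))]
    exact (mul_le_of_le_one_left (hu.nonneg z) (by linarith [hχ0 z])).trans (huM z)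
  have hAle : ‖∫ z, ((1 - χ z) * u z) • Δ z‖ ≤ (2 * Real.pi * M + 1) / r * ‖x - y‖ := by
    obtain ⟨hi, he⟩ := integrable_mul_rpow_norm_sub (s := 1) one_pos one_le_two hu.integrable
      (.of_forall hu.nonneg) hu.ae_le y
    rw [hu.integral_eq_one] at he
    refine (norm_integral_le_of_norm_le (hi.const_mul (‖x - y‖ / r)) ?_).trans ?_
    · filter_upwards [ae_ne_plane x, ae_ne_plane y] with z hzx hzy
      have hzx' := norm_pos_iff.2 (sub_ne_zero.2 hzx.symm)
      have hzy' := norm_pos_iff.2 (sub_ne_zero.2 hzy.symm)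
      have h1 := norm_coulombKernel_sub_le ρ (sub_ne_zero.2 hzx.symm) (sub_ne_zero.2 hzy.symm)
      rw [sub_sub_sub_cancel_right] at h1
      rw [norm_smul, Real.norm_of_nonneg (mul_nonneg (by linarith [hχ1 z]) (hu.nonneg z)),
        show (1 : ℝ) - 2 = -1 by norm_num, Real.rpow_neg_one]
      calc _ ≤ (‖x - z‖ / r * u z) * (‖x - y‖ / (‖x - z‖ * ‖y - z‖)) := by
            gcongr
            · exact mul_nonneg (by positivity) (hu.nonneg z)
            · exact hu.nonneg z
            · exact one_sub_tent_le r _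
        _ = _ := by field_simp
    · rw [integral_const_mul]
      calc _ ≤ ‖x - y‖ / r * (M * (2 * Real.pi / 1) + 1) := by gcongr
        _ = _ := by ring
  -- near `x`, the Hölder increment of the density compensates the singularity
  have hB : Integrable (fun z => χ z * (u z - u x)) := by
    have h1 : Integrable (fun z => χ z * u z) := by
      have := hu.integrable.sub hA
      refine this.congr (.of_forall fun z => ?_)
      simp only [Pi.sub_apply]; ring
    refine (h1.sub (hχi.mul_const (u x))).congr (.of_forall fun z => ?_)
    simp only [Pi.sub_apply]; ring
  have hBM : ∀ᵐ z, |χ z * (u z - u x)| ≤ M := .of_forall fun z => by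
    rw [abs_mul, abs_of_nonneg (hχ0 z)]
    have : |u z - u x| ≤ M := abs_sub_le_of_nonneg_of_le (hu.nonneg z) (huM z) (hu.nonneg x) (huM x)
    exact (mul_le_of_le_one_left (abs_nonneg _) (hχ1 z)).trans this
  have hBle : ‖∫ z, (χ z * (u z - u x)) • Δ z‖ ≤ 2 * H * (2 * Real.pi / γ + V) * ‖x - y‖ := by
    have h := fun y => integrable_mul_rpow_norm_sub (s := γ) hγ (by linarith) hχi
      (.of_forall hχ0) (.of_forall hχ1) y
    have hχV : ∫ z, χ z ≤ V := by
      rw [integral_sub_left_eq_self (tent r) volume x]; exact integral_tent_le hr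
    refine (norm_integral_le_of_norm_le (((h x).1.add (h y).1).const_mul (H * ‖x - y‖)) ?_).trans ?_
    · filter_upwards [ae_ne_plane x, ae_ne_plane y] with z hzx hzy
      have hzx' := norm_pos_iff.2 (sub_ne_zero.2 hzx.symm)
      have hzy' := norm_pos_iff.2 (sub_ne_zero.2 hzy.symm)
      have h1 := norm_coulombKernel_sub_le ρ (sub_ne_zero.2 hzx.symm) (sub_ne_zero.2 hzy.symm)
      rw [sub_sub_sub_cancel_right] at h1
      have h2 : χ z * |u z - u x| ≤ χ z * (H * ‖x - z‖ ^ γ) := by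
        by_cases hz : ‖x - z‖ ≤ r
        · exact mul_le_mul_of_nonneg_left (hol x z hz) (hχ0 z)
        · have h0 := tent_le_indicator hr (x - z)
          rw [indicator_of_notMem (by simpa using hz)] at h0
          have : χ z = 0 := le_antisymm h0 (tent_nonneg _ _)
          simp [this]
      have h3 := rpow_mul_inv_le hzx' hzy' hγ1
      rw [norm_smul, norm_mul, Real.norm_of_nonneg (hχ0 z), Real.norm_eq_abs]
      have e : ‖x - z‖ ^ (γ - 1) = ‖x - z‖ ^ γ * ‖x - z‖⁻¹ := by
        rw [Real.rpow_sub_one hzx'.ne', div_eq_mul_inv]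
      calc _ ≤ (χ z * (H * ‖x - z‖ ^ γ)) * (‖x - y‖ / (‖x - z‖ * ‖y - z‖)) := by
            have := hχ0 z
            gcongr
        _ = H * ‖x - y‖ * (χ z * (‖x - z‖ ^ (γ - 1) * ‖y - z‖⁻¹)) := by
            rw [e]; field_simp
        _ ≤ H * ‖x - y‖ * (χ z * (‖x - z‖ ^ (γ - 2) + ‖y - z‖ ^ (γ - 2))) := by
            have := hχ0 z
            gcongr
        _ = _ := by simp only [Pi.add_apply]; ring
    · rw [integral_const_mul, integral_add' (h x).1 (h y).1]
      calc _ ≤ H * ‖x - y‖ * ((1 * (2 * Real.pi / γ) + V) + (1 * (2 * Real.pi / γ) + V)) := by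
            gcongr
            · exact (h x).2.trans (by gcongr)
            · exact (h y).2.trans (by gcongr)
        _ = _ := by ring
  -- the contribution of the frozen density `u x` cancels by symmetry
  have hC : ∀ᵐ z, |χ z| ≤ 1 := .of_forall fun z => by
    rw [abs_of_nonneg (hχ0 z)]; exact hχ1 z
  have hCle : ‖u x • ∫ z, χ z • Δ z‖ ≤ M * ((2 * Real.pi + 2 * V) / r) * ‖x - y‖ := by
    rw [norm_smul, Real.norm_of_nonneg (hu.nonneg x), mul_assoc]
    gcongr
    · exact huM x
    · exact norm_integral_tent_smul_sub_le ρ hr x y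
  have hCint : Integrable (fun z => u x • χ z • Δ z) := (hΔint hχi hC).smul (u x)
  have heq : coulombField ρ u x - coulombField ρ u y = (∫ z, ((1 - χ z) * u z) • Δ z)
      + (∫ z, (χ z * (u z - u x)) • Δ z) + u x • ∫ z, χ z • Δ z := by
    rw [coulombField, coulombField,
      ← integral_sub (integrable_smul_coulombKernel ρ hu.integrable hu.ae_abs_le x).1
        (integrable_smul_coulombKernel ρ hu.integrable hu.ae_abs_le y).1,
      ← integral_smul, ← integral_add' (hΔint hA hAM) (hΔint hB hBM),
      ← integral_add' ((hΔint hA hAM).add (hΔint hB hBM)) hCint]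
    refine integral_congr_ae (.of_forall fun z => ?_)
    simp only [hΔ, Pi.add_apply]
    module
  rw [heq]
  refine (norm_add₃_le.trans (add_le_add (add_le_add hAle hBle) hCle)).trans_eq ?_
  ring

/-! ### Osgood's argument for log-Lipschitz fields -/

/-- The choice `θ = 1 / (1 - log b)` in the Hölder bound of exponent `1 - θ` costs only a factor
`e` compared with a Lipschitz bound. -/
lemma rpow_one_sub_inv_le {b l : ℝ} (hl : 1 ≤ l) (hb : b = Real.exp (1 - l)) :
    b ^ (1 - l⁻¹) ≤ Real.exp 1 * b := by
  rw [hb, ← Real.exp_mul, ← Real.exp_add, Real.exp_le_exp]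
  have hl0 : l ≠ 0 := by positivity
  have : (1 - l) * (1 - l⁻¹) = 2 - l - l⁻¹ := by field_simp; ring
  rw [this]
  have : 0 ≤ l⁻¹ := by positivity
  linarith

/-- Time reversal of a curve that is differentiable on `[0,T]`. -/
lemma hasDerivWithinAt_time_reversal {E : Type*} [NormedAddCommGroup E] [NormedSpace ℝ E]
    {T t : ℝ} {f f' : ℝ → E} (hf : ∀ s ∈ Icc 0 T, HasDerivWithinAt f (f' s) (Icc 0 T) s)
    (ht : t ∈ Icc 0 T) : ContinuousOn (fun σ => f (t - σ)) (Icc 0 t) ∧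
      ∀ σ ∈ Ico 0 t, HasDerivWithinAt (fun σ => f (t - σ)) (-f' (t - σ)) (Ici σ) σ := by
  have hmaps : MapsTo (fun σ => t - σ) (Icc 0 t) (Icc 0 T) := fun σ hσ =>
    ⟨by linarith [hσ.2], by linarith [hσ.1, ht.2]⟩
  have h : ∀ σ ∈ Icc 0 t, HasDerivWithinAt (fun σ => f (t - σ)) (-f' (t - σ)) (Icc 0 t) σ := by
    intro σ hσ
    have h1 : HasDerivWithinAt (fun σ => t - σ) (-1) (Icc 0 t) σ :=
      ((hasDerivAt_id σ).const_sub t).hasDerivWithinAt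
    have h2 := (hf (t - σ) (hmaps hσ)).scomp σ h1 hmaps
    rwa [neg_one_smul] at h2
  exact ⟨fun σ hσ => (h σ hσ).continuousWithinAt, fun σ hσ =>
    (h σ (Ico_subset_Icc_self hσ)).mono_of_mem_nhdsWithin (Icc_mem_nhdsGE_of_mem hσ)⟩

/-- Osgood's argument. If the force has Hölder constants `A / θ` of exponent `1 - θ` for all
`θ ∈ (0,1]`, then it is log-Lipschitz, and the distance of two trajectories stays below the
solution `exp (1 - l exp (-K σ))` of `b' = K b (1 - log b)`. Hence the flow is Hölder continuous
with the exponent `exp (-K T)`. -/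
lemma norm_sub_le_rpow_of_logLipschitz {T A : ℝ} (hA : 0 ≤ A) {G : ℝ → Plane → Plane}
    (hG : ∀ s ∈ Icc 0 T, ∀ θ : ℝ, 0 < θ → θ ≤ 1 → ∀ q q', ‖G s q - G s q'‖
      ≤ A / θ * ‖q - q'‖ ^ (1 - θ))
    {x y : ℝ → Phase}
    (hx : ∀ s ∈ Icc 0 T, HasDerivWithinAt x ((x s).2, G s (x s).1) (Icc 0 T) s)
    (hy : ∀ s ∈ Icc 0 T, HasDerivWithinAt y ((y s).2, G s (y s).1) (Icc 0 T) s)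
    {t : ℝ} (ht : t ∈ Icc 0 T) (hne : x t ≠ y t)
    (hsmall : ‖x t - y t‖ ≤ Real.exp (1 - Real.exp ((A * Real.exp 1 + 2) * T)))
    {s : ℝ} (hs : s ∈ Icc 0 t) :
    ‖x s - y s‖ ≤ Real.exp 1 * ‖x t - y t‖ ^ Real.exp (-((A * Real.exp 1 + 2) * T)) := by
  set K := A * Real.exp 1 + 2 with hK
  have hK0 : 0 < K := by positivity
  set d := ‖x t - y t‖ with hd
  have hd0 : 0 < d := norm_pos_iff.2 (sub_ne_zero.2 hne)
  set l := 1 - Real.log d with hl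
  have hl1 : Real.exp (K * T) ≤ l := by
    have := Real.log_le_log hd0 hsmall
    rw [Real.log_exp] at this
    linarith
  have hl0 : 0 < l := (Real.exp_pos _).trans_le hl1
  -- the exponent of the comparison function stays above `1`, so that function stays below `1`
  have hle : ∀ σ, σ ≤ T → 1 ≤ l * Real.exp (-(K * σ)) := fun σ hσ => by
    calc 1 = Real.exp (K * T) * Real.exp (-(K * T)) := by rw [← Real.exp_add]; simp
      _ ≤ l * Real.exp (-(K * σ)) := by gcongr
  set f : ℝ → Phase := fun r => x r - y r with hf
  obtain ⟨hc, hder⟩ := hasDerivWithinAt_time_reversal (f := f)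
    (f' := fun r => ((x r).2, G r (x r).1) - ((y r).2, G r (y r).1))
    (fun r hr => (hx r hr).sub (hy r hr)) ht
  have hB : ∀ σ, HasDerivAt (fun σ => Real.exp (1 - l * Real.exp (-(K * σ))))
      (K * (Real.exp (1 - l * Real.exp (-(K * σ))) * (l * Real.exp (-(K * σ))))) σ := fun σ => by
    have h1 : HasDerivAt (fun σ => 1 - l * Real.exp (-(K * σ)))
        (-(l * (Real.exp (-(K * σ)) * (-(K * 1))))) σ :=
      ((((hasDerivAt_id σ).const_mul K).neg.exp).const_mul l).const_sub 1
    convert h1.exp using 1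
    ring
  have hcomp := image_norm_le_of_norm_deriv_right_lt_deriv_boundary hc hder
    (B := fun σ => Real.exp (1 - l * Real.exp (-(K * σ)))) ?_ hB ?_
    (x := t - s) ⟨by linarith [hs.2], by linarith [hs.1]⟩
  · rw [sub_sub_cancel] at hcomp
    refine hcomp.trans ?_
    have hsT : t - s ≤ T := by linarith [hs.1, ht.2]
    calc Real.exp (1 - l * Real.exp (-(K * (t - s))))
        ≤ Real.exp (1 + Real.log d * Real.exp (-(K * T))) := by
          rw [Real.exp_le_exp]
          have h1 : Real.exp (-(K * T)) ≤ Real.exp (-(K * (t - s))) := by gcongr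
          have h2 : l * Real.exp (-(K * T)) ≤ l * Real.exp (-(K * (t - s))) := by gcongr
          have h3 := Real.exp_pos (-(K * T))
          have h4 : l * Real.exp (-(K * T))
            = Real.exp (-(K * T)) - Real.log d * Real.exp (-(K * T)) := by rw [hl]; ring
          linarith
      _ = _ := by rw [Real.exp_add, Real.rpow_def_of_pos hd0]
  · simp only [sub_zero, mul_zero, neg_zero, Real.exp_zero, mul_one, hl, sub_sub_cancel,
      Real.exp_log hd0]
    exact le_rfl
  · intro σ hσ heq
    set e := l * Real.exp (-(K * σ)) with he
    set b := Real.exp (1 - e) with hb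
    have he1 : 1 ≤ e := hle σ (hσ.2.le.trans ht.2)
    have hb0 : 0 < b := Real.exp_pos _
    have hmem : t - σ ∈ Icc 0 T := ⟨by linarith [hσ.2], by linarith [hσ.1, ht.2]⟩
    have h1 : ‖(x (t - σ)).1 - (y (t - σ)).1‖ ≤ b := by
      rw [← heq]; exact norm_fst_le (f (t - σ))
    have h2 : ‖(x (t - σ)).2 - (y (t - σ)).2‖ ≤ b := by
      rw [← heq]; exact norm_snd_le (f (t - σ))
    have hinv : e⁻¹ ≤ 1 := inv_le_one_of_one_le₀ he1
    have h3 : ‖G (t - σ) (x (t - σ)).1 - G (t - σ) (y (t - σ)).1‖ ≤ A * Real.exp 1 * (b * e) := by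
      calc _ ≤ A / e⁻¹ * ‖(x (t - σ)).1 - (y (t - σ)).1‖ ^ (1 - e⁻¹) :=
            hG _ hmem e⁻¹ (by positivity) hinv _ _
        _ ≤ A / e⁻¹ * (Real.exp 1 * b) := by
            gcongr
            exact (Real.rpow_le_rpow (norm_nonneg _) h1 (by linarith)).trans
              (rpow_one_sub_inv_le he1 hb)
        _ = _ := by rw [div_inv_eq_mul]; ring
    have hbe : b ≤ b * e := le_mul_of_one_le_right hb0.le he1
    rw [norm_neg, Prod.norm_def, max_lt_iff]
    have hAe : 0 ≤ A * Real.exp 1 * (b * e) := by positivity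
    have hKe : K * (b * e) = A * Real.exp 1 * (b * e) + 2 * (b * e) := by rw [hK]; ring
    have hpos : 0 < b * e := by positivity
    constructor
    · exact lt_of_le_of_lt h2 (by rw [hKe]; linarith)
    · exact lt_of_le_of_lt h3 (by rw [hKe]; linarith)

/-! ### Transport along the characteristics -/

lemma IsVlasovSolution.hasFDerivAt {a β T : ℝ} {N : ℕ∞} {k₀ : Phase → ℝ} {k : ℝ → Phase → ℝ}
    (hk : IsVlasovSolution a β T N k₀ k) {t : ℝ} (ht : t ∈ Icc 0 T) (X : Phase) :
    HasFDerivAt (k t) ((fderivWithin ℝ (fun z : ℝ × Phase => k z.1 z.2)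
      (Icc 0 T ×ˢ (univ : Set Phase)) (t, X)).comp (ContinuousLinearMap.inr ℝ ℝ Phase)) X := by
  have hF := (hk.differentiable (t, X) ⟨ht, mem_univ _⟩).hasFDerivWithinAt
  rw [← hasFDerivWithinAt_univ]
  exact hF.comp X (hasFDerivAt_prodMk_right t X).hasFDerivWithinAt fun Y _ => ⟨ht, mem_univ _⟩

/-- A solution of the Vlasov–Poisson equation is constant along the characteristics. -/
lemma IsVlasovSolution.eq_initial_comp_flow {a β T : ℝ} {N : ℕ∞} {k₀ : Phase → ℝ}
    {k : ℝ → Phase → ℝ} {φ : ℝ → ℝ → Phase → Phase} (hT : 0 < T)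
    (hk : IsVlasovSolution a β T N k₀ k) (hφ : IsMeanFieldFlow a β T N k φ)
    {s : ℝ} (hs : s ∈ Icc 0 T) (X : Phase) : k s X = k₀ (φ 0 s X) := by
  have hder : ∀ r ∈ Icc 0 T, HasDerivWithinAt (fun r => k r (φ r s X)) 0 (Icc 0 T) r := by
    intro r hr
    set Y := φ r s X with hY
    have hF := (hk.differentiable (r, Y) ⟨hr, mem_univ _⟩).hasFDerivWithinAt
    set L := fderivWithin ℝ (fun z : ℝ × Phase => k z.1 z.2)
      (Icc 0 T ×ˢ (univ : Set Phase)) (r, Y) with hL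
    have h1 : HasDerivWithinAt (fun r => k r (φ r s X))
        (L (1, (Y.2, meanFieldForce a β N (k r) Y.1))) (Icc 0 T) r :=
      HasFDerivWithinAt.comp_hasDerivWithinAt (f := fun r => (r, φ r s X)) r hF
        ((hasDerivWithinAt_id r (Icc 0 T)).prodMk (hφ.equation s hs X r hr))
        fun r' hr' => ⟨hr', mem_univ _⟩
    have h2 : HasDerivWithinAt (fun r => k r Y) (L (1, 0)) (Icc 0 T) r :=
      HasFDerivWithinAt.comp_hasDerivWithinAt (f := fun r => (r, Y)) r hF
        ((hasDerivWithinAt_id r (Icc 0 T)).prodMk (hasDerivWithinAt_const r (Icc 0 T) Y))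
        fun r' hr' => ⟨hr', mem_univ _⟩
    have h3 := (hk.hasFDerivAt hr Y).fderiv
    have heq := hk.equation r hr Y
    rw [h2.derivWithin (uniqueDiffOn_Icc hT r hr), h3, ← hL] at heq
    convert h1 using 1
    rw [← heq]
    simp only [ContinuousLinearMap.comp_apply, ContinuousLinearMap.inr_apply, ← map_add]
    simp
  have h := Convex.norm_image_sub_le_of_norm_hasDerivWithin_le (C := 0) hder (by simp)
    (convex_Icc 0 T) hs (left_mem_Icc.2 hT.le)
  rw [zero_mul, norm_le_zero_iff, sub_eq_zero, hφ.initial s hs, hk.initial] at h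
  exact h.symm

lemma IsMeanFieldFlow.norm_snd_sub_le {a β T A : ℝ} {N : ℕ∞} {k : ℝ → Phase → ℝ}
    {φ : ℝ → ℝ → Phase → Phase} (hφ : IsMeanFieldFlow a β T N k φ)
    (hF : ∀ t ∈ Icc 0 T, ∀ q, ‖meanFieldForce a β N (k t) q‖ ≤ A)
    {s t : ℝ} (hs : s ∈ Icc 0 T) (ht : t ∈ Icc 0 T) (X : Phase) :
    ‖(φ t s X).2 - X.2‖ ≤ A * T := by
  have h := Convex.norm_image_sub_le_of_norm_hasDerivWithin_le (C := A)
    (fun r hr => (hφ.equation s hs X r hr).snd)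
    (fun r hr => hF r hr _) (convex_Icc 0 T) hs ht
  simp only [hφ.initial s hs] at h
  have hA : 0 ≤ A := (norm_nonneg _).trans (hF s hs 0)
  refine h.trans (mul_le_mul_of_nonneg_left ?_ hA)
  rw [Real.norm_eq_abs, abs_le]
  constructor <;> linarith [hs.1, hs.2, ht.1, ht.2]

/-! ### Hölder continuity of the spatial density -/

lemma norm_snd_le_phaseNorm (X : Phase) : ‖X.2‖ ≤ phaseNorm X :=
  Real.le_sqrt_of_sq_le (by nlinarith [sq_nonneg ‖X.1‖])

/-- At points whose momenta are within `A` of `p`, the decay of the gradient of `k₀` is that of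
`(1 + ‖p‖) ^ (-(2 + δ))`, up to a factor depending on `A`. -/
lemma abs_sub_le_of_decay {k₀ : Phase → ℝ} (hdiff : Differentiable ℝ k₀) {D δ : ℝ} (hδ : 0 < δ)
    (hdecay : ∀ X, ‖fderiv ℝ k₀ X‖ ≤ D / (1 + phaseNorm X) ^ (2 + δ)) {p : Plane} {A : ℝ}
    {X Y : Phase} (hX : ‖X.2 - p‖ ≤ A) (hY : ‖Y.2 - p‖ ≤ A) :
    |k₀ X - k₀ Y| ≤ D * (1 + A) ^ (2 + δ) * (1 + ‖p‖) ^ (-(2 + δ)) * ‖X - Y‖ := by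
  have hA : 0 ≤ A := (norm_nonneg _).trans hX
  have hD : 0 ≤ D := by
    have h := (norm_nonneg _).trans (hdecay 0)
    simpa [phaseNorm] using h
  refine Convex.norm_image_sub_le_of_norm_fderiv_le (𝕜 := ℝ) (f := k₀)
    (s := univ ×ˢ Metric.closedBall p A) (fun Z _ => hdiff Z) (fun Z hZ => (hdecay Z).trans ?_)
    (convex_univ.prod (convex_closedBall p A))
    ⟨mem_univ _, by simpa [dist_eq_norm] using hY⟩ ⟨mem_univ _, by simpa [dist_eq_norm] using hX⟩
  have hZ2 : ‖Z.2 - p‖ ≤ A := by simpa [dist_eq_norm] using hZ.2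
  have h1 : 1 + ‖p‖ ≤ (1 + A) * (1 + phaseNorm Z) := by
    have h2 : ‖p‖ ≤ ‖Z.2‖ + ‖Z.2 - p‖ := norm_le_norm_add_norm_sub Z.2 p
    have h3 := norm_snd_le_phaseNorm Z
    have h4 : 0 ≤ phaseNorm Z := Real.sqrt_nonneg _
    nlinarith
  have h4 : 0 ≤ phaseNorm Z := Real.sqrt_nonneg _
  rw [Real.rpow_neg (by positivity), ← div_eq_mul_inv,
    div_le_div_iff₀ (by positivity) (by positivity), mul_assoc,
    ← Real.mul_rpow (by positivity) (by positivity)]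
  gcongr

/-- The spatial density of `k₀ ∘ Ψ` inherits Hölder continuity in the position from `Ψ`, because the
gradient of `k₀` is integrable in the momentum and `Ψ` changes momenta by at most `A`. -/
lemma abs_spatialDensity_sub_le {k₀ u : Phase → ℝ} (hdiff : Differentiable ℝ k₀) {D δ : ℝ}
    (hδ : 0 < δ) (hdecay : ∀ X, ‖fderiv ℝ k₀ X‖ ≤ D / (1 + phaseNorm X) ^ (2 + δ))
    (hu : Integrable u) (huc : Continuous u) {Ψ : Phase → Phase} (hΨ : ∀ X, u X = k₀ (Ψ X))
    {A : ℝ} (hA : ∀ X, ‖(Ψ X).2 - X.2‖ ≤ A) {r E γ : ℝ} (hr : 0 < r)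
    (hol : ∀ q q' p, ‖q - q'‖ ≤ r → ‖Ψ (q, p) - Ψ (q', p)‖ ≤ E * ‖q - q'‖ ^ γ)
    {q q' : Plane} (hq : ‖q - q'‖ ≤ r) :
    |spatialDensity u q - spatialDensity u q'|
      ≤ D * (1 + A) ^ (2 + δ) * E * (∫ p : Plane, (1 + ‖p‖) ^ (-(2 + δ))) * ‖q - q'‖ ^ γ := by
  have hA0 : 0 ≤ A := (norm_nonneg _).trans (hA 0)
  have hD : 0 ≤ D := by
    have h := (norm_nonneg _).trans (hdecay 0)
    simpa [phaseNorm] using h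
  have hw : Integrable (fun p : Plane => (1 + ‖p‖) ^ (-(2 + δ))) :=
    integrable_one_add_norm (by simp [hδ])
  have hb : ∀ q q' : Plane, ‖q - q'‖ ≤ r → ∀ p, ‖u (q, p) - u (q', p)‖
      ≤ D * (1 + A) ^ (2 + δ) * E * ‖q - q'‖ ^ γ * (1 + ‖p‖) ^ (-(2 + δ)) := by
    intro q q' hq p
    rw [hΨ, hΨ, Real.norm_eq_abs]
    calc _ ≤ D * (1 + A) ^ (2 + δ) * (1 + ‖p‖) ^ (-(2 + δ)) * ‖Ψ (q, p) - Ψ (q', p)‖ :=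
          abs_sub_le_of_decay hdiff hδ hdecay (hA (q, p)) (hA (q', p))
      _ ≤ D * (1 + A) ^ (2 + δ) * (1 + ‖p‖) ^ (-(2 + δ)) * (E * ‖q - q'‖ ^ γ) := by
          gcongr; exact hol q q' p hq
      _ = _ := by ring
  have hdint : ∀ q q' : Plane, ‖q - q'‖ ≤ r → Integrable fun p => u (q, p) - u (q', p) :=
    fun q q' hq => (hw.const_mul _).mono' (by fun_prop) (.of_forall (hb q q' hq))
  -- sections are integrable for almost every position, hence, by comparison, for every position
  have hint : ∀ q : Plane, Integrable fun p => u (q, p) := fun q => by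
    have hae : ∀ᵐ q : Plane, Integrable fun p => u (q, p) :=
      Integrable.prod_right_ae (by rwa [← Measure.volume_eq_prod])
    obtain ⟨q₀, hq₀, hdist⟩ := (Measure.dense_of_ae hae).exists_dist_lt q hr
    rw [dist_eq_norm] at hdist
    exact ((hdint q q₀ hdist.le).add hq₀).congr (.of_forall fun p => by simp)
  rw [spatialDensity, spatialDensity, ← integral_sub (hint q) (hint q'), ← Real.norm_eq_abs]
  refine (norm_integral_le_of_norm_le (hw.const_mul _) (.of_forall (hb q q' hq))).trans_eq ?_
  rw [integral_const_mul]
  ring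

/-- An essential bound of a density holds everywhere once the density is continuous. -/
lemma forall_le_of_ae_le_of_holder {u : Plane → ℝ} {M H γ r : ℝ} (hae : ∀ᵐ z, u z ≤ M) (hr : 0 < r)
    (hγ : 0 < γ) (hol : ∀ x z, ‖x - z‖ ≤ r → |u z - u x| ≤ H * ‖x - z‖ ^ γ) (z : Plane) :
    u z ≤ M := by
  have hc : Continuous u := by
    rw [continuous_iff_continuousAt]
    intro x
    rw [ContinuousAt, tendsto_iff_dist_tendsto_zero]
    have h0 : Filter.Tendsto (fun z => H * ‖x - z‖ ^ γ) (nhds x) (nhds 0) := by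
      have : Continuous fun z => H * ‖x - z‖ ^ γ :=
        continuous_const.mul ((Real.continuous_rpow_const hγ.le).comp (by fun_prop))
      simpa [Real.zero_rpow hγ.ne'] using this.tendsto x
    refine squeeze_zero' (.of_forall fun _ => dist_nonneg) ?_ h0
    filter_upwards [Metric.closedBall_mem_nhds x hr] with z hz
    rw [Real.dist_eq]
    exact hol x z (by rwa [← dist_eq_norm, dist_comm])
  have hcl : IsClosed {z | u z ≤ M} := isClosed_le hc continuous_const
  have hz : z ∈ closure {z | u z ≤ M} := Measure.dense_of_ae hae z
  rwa [hcl.closure_eq] at hz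

/-! ### Lipschitz continuity of the mean-field force -/

lemma IsProbDensity.isBoundedDensity {u : Phase → ℝ} (hu : IsProbDensity u) {M : ℝ}
    (hM : eLpNorm (spatialDensity u) ⊤ volume ≤ ENNReal.ofReal M) (hM0 : 0 ≤ M) :
    IsBoundedDensity M (spatialDensity u) where
  integrable := Integrable.integral_prod_left (by
    rw [← Measure.volume_eq_prod]; exact hu.integrable)
  nonneg q := integral_nonneg fun p => hu.nonneg (q, p)
  integral_eq_one := by
    rw [← hu.integral_eq_one, Measure.volume_eq_prod, integral_prod]
    · rfl
    · rw [← Measure.volume_eq_prod]; exact hu.integrable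
  ae_le := by
    rw [eLpNorm_exponent_top] at hM
    filter_upwards [ae_le_eLpNormEssSup (f := spatialDensity u) (μ := volume)] with q hq
    have h := hq.trans hM
    rw [← ofReal_norm, ENNReal.ofReal_le_ofReal_iff hM0] at h
    exact (le_abs_self _).trans h

lemma exists_meanFieldForce_eq (a β : ℝ) {N : ℕ∞} (hN : 1 ≤ N) :
    ∃ ρ : ℝ, ∀ u q, meanFieldForce a β N u q = a • coulombField ρ (spatialDensity u) q := by
  obtain ⟨ρ, h⟩ := exists_force_eq_smul_coulombKernel a β hN
  refine ⟨ρ, fun u q => ?_⟩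
  simp only [meanFieldForce, coulombField, h, ← integral_smul]
  congr 1
  ext1 z
  rw [smul_comm]

/-- All spatial densities on `[0,T]`, with or without cut-off, have a common bound. -/
lemma exists_forall_isBoundedDensity {T a β : ℝ} {k₀ : Phase → ℝ} {k : ℕ∞ → ℝ → Phase → ℝ}
    (hk : ∀ N : ℕ∞, 1 ≤ N → IsVlasovSolution a β T N k₀ (k N))
    (hsup : (⨆ (n : ℕ) (_ : 1 ≤ n), ⨆ s ∈ Icc 0 T,
      eLpNorm (spatialDensity (k n s)) ⊤ volume) < ⊤) :
    ∃ M : ℝ, 0 ≤ M ∧ ∀ N : ℕ∞, 1 ≤ N → ∀ t ∈ Icc 0 T,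
      IsBoundedDensity M (spatialDensity (k N t)) := by
  have hinf := (hk ⊤ le_top).bounded
  set S := ⨆ (n : ℕ) (_ : 1 ≤ n), ⨆ s ∈ Icc 0 T, eLpNorm (spatialDensity (k n s)) ⊤ volume with hS
  set S' := ⨆ t ∈ Icc 0 T, eLpNorm (spatialDensity (k ⊤ t)) ⊤ volume with hS'
  have hlt : max S S' < ⊤ := max_lt hsup hinf
  refine ⟨(max S S').toReal, ENNReal.toReal_nonneg, fun N hN t ht =>
    ((hk N hN).density t ht).isBoundedDensity ?_ ENNReal.toReal_nonneg⟩
  rw [ENNReal.ofReal_toReal hlt.ne]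
  induction N using ENat.recTopCoe with
  | top =>
    exact (le_iSup₂ (f := fun t (_ : t ∈ Icc 0 T) =>
      eLpNorm (spatialDensity (k ⊤ t)) ⊤ volume) t ht).trans (le_max_right _ _)
  | coe n =>
    have hn : 1 ≤ n := by exact_mod_cast hN
    refine le_trans ?_ (le_max_left _ _)
    refine le_trans ?_ (le_iSup₂ (f := fun (n : ℕ) (_ : 1 ≤ n) => ⨆ s ∈ Icc 0 T,
      eLpNorm (spatialDensity (k n s)) ⊤ volume) n hn)
    exact le_iSup₂ (f := fun t (_ : t ∈ Icc 0 T) =>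
      eLpNorm (spatialDensity (k n t)) ⊤ volume) t ht

/-- The mean-field force is Lipschitz, with a constant that depends only on the initial datum and
on a common bound for the spatial densities. -/
lemma exists_lipschitz_meanFieldForce {T a β : ℝ} (hT : 0 < T) {k₀ : Phase → ℝ}
    (hdiff : Differentiable ℝ k₀) {D δ : ℝ} (hδ : 0 < δ)
    (hdecay : ∀ X, ‖fderiv ℝ k₀ X‖ ≤ D / (1 + phaseNorm X) ^ (2 + δ)) {M : ℝ} (hM : 0 ≤ M) :
    ∃ L : ℝ, ∀ (N : ℕ∞) (k : ℝ → Phase → ℝ) (φ : ℝ → ℝ → Phase → Phase), 1 ≤ N →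
      IsVlasovSolution a β T N k₀ k → IsMeanFieldFlow a β T N k φ →
      (∀ t ∈ Icc 0 T, IsBoundedDensity M (spatialDensity (k t))) →
      ∀ t ∈ Icc 0 T, ∀ q q', ‖meanFieldForce a β N (k t) q - meanFieldForce a β N (k t) q'‖
        ≤ L * ‖q - q'‖ := by
  have hπ := Real.pi_pos
  have hD : 0 ≤ D := by
    have h := (norm_nonneg _).trans (hdecay 0)
    simpa [phaseNorm] using h
  set A : ℝ := |a| * (4 * (2 * Real.pi * M + 1)) with hA
  set K : ℝ := A * Real.exp 1 + 2 with hK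
  set γ : ℝ := Real.exp (-(K * T)) with hγ
  set r : ℝ := Real.exp (1 - Real.exp (K * T)) with hr
  set F : ℝ := |a| * (2 * Real.pi * M + 1) with hF
  set H : ℝ := D * (1 + F * T) ^ (2 + δ) * Real.exp 1
    * (∫ p : Plane, (1 + ‖p‖) ^ (-(2 + δ))) with hH
  have hA0 : 0 ≤ A := by positivity
  have hH0 : 0 ≤ H := by
    have : 0 ≤ ∫ p : Plane, (1 + ‖p‖) ^ (-(2 + δ)) := integral_nonneg fun p => by positivity
    positivity
  have hγ1 : γ ≤ 1 := Real.exp_le_one_iff.2 (by rw [neg_nonpos]; positivity)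
  refine ⟨|a| * ((2 * Real.pi * M + 1) / r
    + 2 * H * (2 * Real.pi / γ + volume.real (Metric.closedBall (0 : Plane) r))
    + M * ((2 * Real.pi + 2 * volume.real (Metric.closedBall (0 : Plane) r)) / r)), ?_⟩
  intro N k φ hN hk hφ hu t ht
  obtain ⟨ρ, hρ⟩ := exists_meanFieldForce_eq a β hN
  have hbound : ∀ t ∈ Icc 0 T, ∀ q, ‖meanFieldForce a β N (k t) q‖ ≤ F := fun t ht q => by
    rw [hρ, norm_smul, Real.norm_eq_abs]
    exact mul_le_mul_of_nonneg_left (norm_coulombField_le ρ (hu t ht) q) (abs_nonneg a)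
  have hG : ∀ s ∈ Icc 0 T, ∀ θ : ℝ, 0 < θ → θ ≤ 1 → ∀ q q',
      ‖meanFieldForce a β N (k s) q - meanFieldForce a β N (k s) q'‖
        ≤ A / θ * ‖q - q'‖ ^ (1 - θ) := fun s hs θ hθ hθ1 q q' => by
    rw [hρ, hρ, ← smul_sub, norm_smul, Real.norm_eq_abs]
    have h1 : 1 ≤ 1 / θ := (one_le_div hθ).2 hθ1
    calc _ ≤ |a| * (4 * (2 * Real.pi * M / θ + 1) * ‖q - q'‖ ^ (1 - θ)) := by
          gcongr; exact norm_coulombField_sub_le_rpow ρ (hu s hs) hθ hθ1 q q'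
      _ ≤ |a| * (4 * (2 * Real.pi * M / θ + 1 / θ) * ‖q - q'‖ ^ (1 - θ)) := by gcongr
      _ = _ := by rw [hA]; ring
  have hosgood : ∀ q q' p : Plane, ‖q - q'‖ ≤ r →
      ‖φ 0 t (q, p) - φ 0 t (q', p)‖ ≤ Real.exp 1 * ‖q - q'‖ ^ γ := by
    intro q q' p hq
    rcases eq_or_ne q q' with rfl | hne
    · simp only [sub_self, norm_zero]; positivity
    have hnorm : ‖φ t t (q, p) - φ t t (q', p)‖ = ‖q - q'‖ := by
      rw [hφ.initial t ht, hφ.initial t ht]; simp [Prod.norm_def]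
    have h := norm_sub_le_rpow_of_logLipschitz hA0 hG (hφ.equation t ht (q, p))
      (hφ.equation t ht (q', p)) ht
      (by rw [hφ.initial t ht, hφ.initial t ht]; simpa using hne) (by rwa [hnorm])
      (left_mem_Icc.2 ht.1)
    rwa [hnorm] at h
  have hol : ∀ x z, ‖x - z‖ ≤ r →
      |spatialDensity (k t) z - spatialDensity (k t) x| ≤ H * ‖x - z‖ ^ γ := by
    intro x z hxz
    rw [norm_sub_rev] at hxz ⊢
    exact abs_spatialDensity_sub_le hdiff hδ hdecay (hk.density t ht).integrable
      (Differentiable.continuous (𝕜 := ℝ) fun X => (hk.hasFDerivAt ht X).differentiableAt)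
      (hk.eq_initial_comp_flow hT hφ ht)
      (hφ.norm_snd_sub_le hbound ht (left_mem_Icc.2 hT.le)) (Real.exp_pos _) hosgood hxz
  intro q q'
  rw [hρ, hρ, ← smul_sub, norm_smul, Real.norm_eq_abs, mul_assoc]
  gcongr
  exact norm_coulombField_sub_le_of_holder ρ (hu t ht)
    (forall_le_of_ae_le_of_holder (hu t ht).ae_le (Real.exp_pos _) (Real.exp_pos _) hol)
    (Real.exp_pos _) (Real.exp_pos _) hγ1 hH0 hol q q'

/-! ### Gronwall's inequality in the Euclidean norm -/

/-- `phaseNorm` is the norm of an `L²` product; hiding that product behind an arbitrary normed space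
`E` keeps its instances out of the differential inequality below. -/
lemma exists_norm_eq_phaseNorm : ∃ (E : Type) (_ : NormedAddCommGroup E) (_ : NormedSpace ℝ E)
    (e : Phase →L[ℝ] E), ∀ X, ‖e X‖ = phaseNorm X :=
  ⟨WithLp 2 (Plane × Plane), inferInstance, inferInstance,
    (WithLp.prodContinuousLinearEquiv 2 ℝ Plane Plane).symm, fun _ => WithLp.prod_norm_eq_of_L2 _⟩

/-- For a force with Lipschitz constant `C ≥ 1` the vector field `(q, p) ↦ (p, G q)` has Lipschitz
constant `C` in the Euclidean norm, so trajectories separate at most like `exp (C |t - t₀|)`, forward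
and (after time reversal) backward in time. -/
lemma phaseNorm_sub_le_mul_exp {T C : ℝ} (hC : 1 ≤ C) {G : ℝ → Plane → Plane}
    (hG : ∀ s ∈ Icc 0 T, ∀ q q', ‖G s q - G s q'‖ ≤ C * ‖q - q'‖) {x y : ℝ → Phase}
    (hx : ∀ s ∈ Icc 0 T, HasDerivWithinAt x ((x s).2, G s (x s).1) (Icc 0 T) s)
    (hy : ∀ s ∈ Icc 0 T, HasDerivWithinAt y ((y s).2, G s (y s).1) (Icc 0 T) s)
    {t t₀ : ℝ} (ht : t ∈ Icc 0 T) (ht₀ : t₀ ∈ Icc 0 T) :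
    phaseNorm (x t - y t) ≤ phaseNorm (x t₀ - y t₀) * Real.exp (C * |t - t₀|) := by
  obtain ⟨E, _, _, e, he⟩ := exists_norm_eq_phaseNorm
  set f : ℝ → E := fun r => e (x r - y r) with hf
  set f' : ℝ → E := fun r => e (((x r).2, G r (x r).1) - ((y r).2, G r (y r).1)) with hf'
  have hder : ∀ r ∈ Icc 0 T, HasDerivWithinAt f (f' r) (Icc 0 T) r := fun r hr =>
    e.hasFDerivAt.comp_hasDerivWithinAt r ((hx r hr).sub (hy r hr))
  have hle : ∀ r ∈ Icc 0 T, ‖f' r‖ ≤ C * ‖f r‖ := fun r hr => by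
    rw [hf, hf', he, he]
    refine Real.sqrt_le_iff.2 ⟨mul_nonneg (by linarith) (Real.sqrt_nonneg _), ?_⟩
    rw [mul_pow, phaseNorm, Real.sq_sqrt (by positivity)]
    have h1 : ‖G r (x r).1 - G r (y r).1‖ ^ 2 ≤ (C * ‖(x r).1 - (y r).1‖) ^ 2 := by
      gcongr; exact hG r hr _ _
    have h2 : 1 * ‖(x r).2 - (y r).2‖ ^ 2 ≤ C ^ 2 * ‖(x r).2 - (y r).2‖ ^ 2 := by
      gcongr; nlinarith
    simp only [Prod.fst_sub, Prod.snd_sub]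
    nlinarith
  rw [← he, ← he]
  rcases le_total t₀ t with h | h
  · have hsub : Icc t₀ t ⊆ Icc 0 T := Icc_subset_Icc ht₀.1 ht.2
    have hg := norm_le_gronwallBound_of_norm_deriv_right_le (f := f) (f' := f') (K := C) (ε := 0)
      (fun r hr => (hder r (hsub hr)).continuousWithinAt.mono hsub)
      (fun r hr => ((hder r (hsub (Ico_subset_Icc_self hr))).mono hsub).mono_of_mem_nhdsWithin
        (Icc_mem_nhdsGE_of_mem hr)) le_rfl
      (fun r hr => by rw [add_zero]; exact hle r (hsub (Ico_subset_Icc_self hr)))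
      t (right_mem_Icc.2 h)
    rwa [gronwallBound_ε0, ← abs_of_nonneg (sub_nonneg.2 h)] at hg
  · obtain ⟨hc, hd⟩ := hasDerivWithinAt_time_reversal hder ht₀
    have hg := norm_le_gronwallBound_of_norm_deriv_right_le (K := C) (ε := 0) hc hd le_rfl
      (fun σ hσ => by
        rw [add_zero, norm_neg]
        exact hle _ ⟨by linarith [hσ.2], by linarith [hσ.1, ht₀.2]⟩)
      (t₀ - t) ⟨by linarith, by linarith [ht.1]⟩
    rwa [gronwallBound_ε0, sub_sub_cancel, sub_zero, sub_zero,
      ← abs_of_nonneg (sub_nonneg.2 h), abs_sub_comm] at hg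

end VlasovPoisson

open VlasovPoisson
theorem lemma1 (T a β : ℝ) (hT : 0 < T) (hβ : 0 < β) (hβ' : β ≤ 2)
    (k₀ : Phase → ℝ) (hk₀ : IsProbDensity k₀)
    (hdiff : Differentiable ℝ k₀)
    (hdecay : ∃ D δ : ℝ, 0 < δ ∧
      ∀ X, ‖fderiv ℝ k₀ X‖ ≤ D / (1 + phaseNorm X) ^ (2 + δ))
    (k : ℕ∞ → ℝ → Phase → ℝ)
    (hk : ∀ N : ℕ∞, 1 ≤ N → IsVlasovSolution a β T N k₀ (k N))
    (φ : ℕ∞ → ℝ → ℝ → Phase → Phase)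
    (hφ : ∀ N : ℕ∞, 1 ≤ N → IsMeanFieldFlow a β T N (k N) (φ N))
    (hsup : (⨆ (n : ℕ) (_ : 1 ≤ n), ⨆ s ∈ Icc 0 T,
      eLpNorm (spatialDensity (k n s)) ⊤ volume) < ⊤) :
    ∃ C : ℝ, 0 < C ∧
      ∀ (X Y : Phase) (N : ℕ∞), 1 ≤ N → ∀ t ∈ Icc 0 T, ∀ t₀ ∈ Icc 0 T,
        phaseNorm (φ N t t₀ X - φ N t t₀ Y)
            ≤ phaseNorm (X - Y) * Real.exp (C * |t - t₀|) ∧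
        ‖meanFieldForce a β N (k N t) X.1 - meanFieldForce a β N (k N t) Y.1‖
            ≤ C * ‖X.1 - Y.1‖ := by
  obtain ⟨D, δ, hδ, hdecay⟩ := hdecay
  obtain ⟨M, hM, hu⟩ := exists_forall_isBoundedDensity hk hsup
  obtain ⟨L, hL⟩ := exists_lipschitz_meanFieldForce (a := a) (β := β) hT hdiff hδ hdecay hM
  have hG : ∀ N : ℕ∞, 1 ≤ N → ∀ s ∈ Icc 0 T, ∀ q q',
      ‖meanFieldForce a β N (k N s) q - meanFieldForce a β N (k N s) q'‖
        ≤ max 1 L * ‖q - q'‖ := fun N hN s hs q q' =>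
    (hL N (k N) (φ N) hN (hk N hN) (hφ N hN) (hu N hN) s hs q q').trans (by
      gcongr; exact le_max_right _ _)
  refine ⟨max 1 L, lt_max_of_lt_left one_pos, fun X Y N hN t ht t₀ ht₀ =>
    ⟨?_, hG N hN t ht _ _⟩⟩
  have h := phaseNorm_sub_le_mul_exp (le_max_left 1 L) (hG N hN)
    ((hφ N hN).equation t₀ ht₀ X) ((hφ N hN).equation t₀ ht₀ Y) ht ht₀
  rwa [(hφ N hN).initial t₀ ht₀, (hφ N hN).initial t₀ ht₀] at h
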